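/- **Setting.** A parking function of length $n$ is a word $a=a_1\cdots a_n$ of positive integers such that, for every $1\le i\le n$, at least $i$ letters of $a$ are $\le i$. For a word $w$ of positive integers let $d(w)=\min\{i : \#\{j : w_j\le i\}<i\}$; the parkization $\mathrm{Park}(w)$ is the parking function obtained from $w$ by repeating the following step until a parking function is reached: decrease by $1$ every letter larger than $d(w)$. Over a commutative ring $R$, $\mathbf{PQSym}$ is the Hopf algebra with basis $\mathbf F_a$, $a$ running over all parking functions (the empty one gives the unit), with product $\mathbf F_a\mathbf F_b=\sum_c \mathbf F_c$, where $c$ runs over the shuffles of $a$ and $b[|a|]$ ($b$ with all letters increased by $|a|$), and coproduct $\Delta\mathbf F_a=\sum_{u\cdot v=a}\mathbf F_{\mathrm{Park}(u)}\otimes\mathbf F_{\mathrm{Park}(v)}$. $\mathbf{CQSym}\subset\mathbf{PQSym}$ is spanned by the sums $\mathbf P^\pi$ of all $\mathbf F_a$ with $a$ a rearrangement of $\pi$, for $\pi$ a nondecreasing parking function. Let $G_n=\sum_a\mathbf F_a$ over all parking functions $a$ of length $n$, and $G^I=G_{i_1}\cdots G_{i_r}$ for a finite sequence $I=(i_1,\dots,i_r)$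 (with $G^{\emptyset}=1$). A nondecreasing word $w$ of positive integers factors greedily as $w=w_1w_2\cdots w_k$, where each $w_i$ is the longest nonempty prefix of the remaining word that is a parking function with all letters shifted by a common integer $b_i \geq 0$. The profile of $w$ is $\mathrm{pf}(w)=\binom{s_1\cdots s_k}{c_1\cdots c_k}$, where $s_i$ is the first letter of $w_i$ and $c_i$ its length; $(c_1,\dots,c_k)$ is its bottom row. A parking biprofile of size $n$ is a pair $(\mathrm{pf}(u),\mathrm{pf}(v))$, where $u,v$ are nondecreasing words whose concatenation $uv$ is a parking function of length $n$. **Theorem.** Let $n\ge 0$. The elements $G_n$ and all $G^I$ belong to $\mathbf{CQSym}$, and $$\Delta G_n=\sum_{(p,q)} G^{I(p)}\otimes G^{I(q)},$$ where $(p,q)$ runs over all parking biprofiles of size $n$, and $I(p)$, $I(q)$ are the bottom rows of $p$ and $q$. The number of terms of this sum, i.e. the number of parking biprofiles of size $n$, is the Catalan number $C_{n+1}=\frac1{n+2}\binom{2n+2}{n+1}$. -/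

import Mathlib

open scoped TensorProduct

/-- A parking function of length `n`: a word `w` of length `n` on the positive integers in which,
for every `i` in `{1, ..., n}`, at least `i` letters are at most `i`. (Equivalently, the
nondecreasing rearrangement `w'` of `w` satisfies `w'_i ≤ i` for all `i`.) -/
def IsParking (w : List ℕ) : Prop :=
  (∀ x ∈ w, 1 ≤ x) ∧ ∀ i ≤ w.length, i ≤ w.countP (fun x => decide (x ≤ i))

instance IsParking.instDecidablePred : DecidablePred IsParking := fun w => by
  unfold IsParking
  infer_instance

/-- The type of all parking functions (of all lengths, including the empty word). -/
def ParkingFunction : Type := {w : List ℕ // IsParking w}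

namespace ParkingFunction

/-- The underlying word. -/
def word (a : ParkingFunction) : List ℕ := Subtype.val a

/-- The length of a parking function. -/
def length (a : ParkingFunction) : ℕ := a.word.length

end ParkingFunction

theorem finite_words (n : ℕ) :
    {w : List ℕ | w.length ≤ n ∧ ∀ x ∈ w, x ≤ n}.Finite := by
  refine ((List.finite_length_le (Fin (n + 1)) n).image (List.map Fin.val)).subset ?_
  rintro w ⟨h1, h2⟩
  refine ⟨w.map (fun x => Fin.ofNat (n + 1) x), by simpa using h1, ?_⟩
  rw [List.map_map]
  conv_rhs => rw [← List.map_id w]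
  refine List.map_congr_left fun x hx => ?_
  have := h2 x hx
  simp only [Function.comp, Fin.val_ofNat, id]
  exact Nat.mod_eq_of_lt (by omega)

theorem IsParking.le_length {w : List ℕ} (h : IsParking w) : ∀ x ∈ w, x ≤ w.length := by
  have h1 := h.2 w.length le_rfl
  have h2 := le_antisymm List.countP_le_length h1
  rw [List.countP_eq_length] at h2
  intro x hx
  simpa using h2 x hx

theorem finite_parkingFunction (n : ℕ) : {a : ParkingFunction | a.length = n}.Finite := by
  refine Set.Finite.of_finite_image ((finite_words n).subset ?_)
    (f := ParkingFunction.word) (fun a _ b _ h => Subtype.ext h)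
  rintro _ ⟨a, ha, rfl⟩
  have ha' : a.word.length = n := ha
  exact ⟨ha'.le, fun x hx => ha' ▸ IsParking.le_length a.2 x hx⟩

/-- The finite set of parking functions of length `n`. -/
noncomputable def PF (n : ℕ) : Finset ParkingFunction := (finite_parkingFunction n).toFinset

/-! ### Parkization -/

theorem exists_lt_of_not_park {w : List ℕ}
    (h : ¬ ∀ i ≤ w.length, i ≤ w.countP (fun x => decide (x ≤ i))) :
    ∃ i, w.countP (fun x => decide (x ≤ i)) < i := by
  push Not at h
  obtain ⟨i, -, hi⟩ := h
  exact ⟨i, hi⟩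

theorem exists_countP_lt (w : List ℕ) : ∃ i, w.countP (fun x => decide (x ≤ i)) < i :=
  ⟨w.length + 1, Nat.lt_succ_of_le List.countP_le_length⟩

/-- `d(w) = min {i | #{j | w_j ≤ i} < i}`. -/
def parkD (w : List ℕ) : ℕ := Nat.find (exists_countP_lt w)

/-- One step of parkization: every letter larger than `d(w)` is decreased by one. -/
def parkStep (w : List ℕ) : List ℕ := w.map (fun x => if parkD w < x then x - 1 else x)

theorem sum_parkStep_lt {w : List ℕ}
    (h : ¬ ∀ i ≤ w.length, i ≤ w.countP (fun x => decide (x ≤ i))) :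
    (parkStep w).sum < w.sum := by
  have hd : parkD w ≤ w.length := by
    push Not at h
    obtain ⟨i, hi, hi'⟩ := h
    exact (Nat.find_min' (exists_countP_lt w) hi').trans hi
  have hlt : w.countP (fun x => decide (x ≤ parkD w)) < parkD w :=
    Nat.find_spec (exists_countP_lt w)
  obtain ⟨x, hx, hxd⟩ : ∃ x ∈ w, parkD w < x := by
    by_contra! hcon
    have : w.countP (fun x => decide (x ≤ parkD w)) = w.length :=
      List.countP_eq_length.2 (by simpa using hcon)
    omega
  have := List.sum_lt_sum (l := w) (fun x => if parkD w < x then x - 1 else x) id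
    (fun i _ => by dsimp; split_ifs <;> omega)
    ⟨x, hx, by simp only [hxd, if_true, id]; omega⟩
  simpa [parkStep] using this

/-- Parkization of a word: repeat the above step until a parking function is reached, i.e. until
`d(w) = |w| + 1`. -/
def park (w : List ℕ) : List ℕ :=
  if ∀ i ≤ w.length, i ≤ w.countP (fun x => decide (x ≤ i)) then w
  else park (parkStep w)
termination_by w.sum
decreasing_by exact sum_parkStep_lt ‹_›

theorem isParking_park (w : List ℕ) (hw : ∀ x ∈ w, 1 ≤ x) : IsParking (park w) := by
  fun_induction park w with
  | case1 w h => exact ⟨hw, h⟩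
  | case2 w h ih =>
    refine ih fun y hy => ?_
    obtain ⟨x, hx, rfl⟩ := List.mem_map.1 hy
    have h1 := hw x hx
    have hlt : w.countP (fun x => decide (x ≤ parkD w)) < parkD w :=
      Nat.find_spec (exists_countP_lt w)
    split_ifs <;> omega

/-- The parkization of a word on the positive integers, as a parking function. -/
def Park (w : List ℕ) (hw : ∀ x ∈ w, 1 ≤ x) : ParkingFunction := ⟨park w, isParking_park w hw⟩

/-! ### The Hopf algebra of parking functions -/

/-- The underlying module of the algebra `PQSym` over `R`: the free `R`-module on symbols `F_a`,
where `a` runs over all parking functions. -/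
def PQSym (R : Type*) [CommRing R] : Type _ := ParkingFunction →₀ R

namespace PQSym

variable (R : Type*) [CommRing R]

noncomputable instance : AddCommGroup (PQSym R) :=
  inferInstanceAs (AddCommGroup (ParkingFunction →₀ R))

noncomputable instance : Module R (PQSym R) :=
  inferInstanceAs (Module R (ParkingFunction →₀ R))

/-- The basis `F_a` of `PQSym`. -/
noncomputable def basisF : Module.Basis ParkingFunction R (PQSym R) :=
  ⟨LinearEquiv.refl R (ParkingFunction →₀ R)⟩

/-- The basis element `F_a`. -/
noncomputable def F (a : ParkingFunction) : PQSym R := basisF R a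

/-- The shifted shuffle of `a` and `b`: all shuffles `c` of the words `a` and `b[k]`, where
`k = |a|` and `b[k]` is `b` with all letters increased by `k`. As the letters of `a` are at most
`k` and those of `b[k]` are larger than `k`, the shuffles are the words whose subword of letters
at most `k` is `a` and whose subword of letters larger than `k` is `b[k]`; they are pairwise
distinct, and all of them are parking functions (of length `|a| + |b|`). -/
noncomputable def shiftedShuffle (a b : ParkingFunction) : Finset ParkingFunction :=
  (PF (a.length + b.length)).filter fun c =>
    c.word.filter (fun x => decide (x ≤ a.length)) = a.word ∧
    c.word.filter (fun x => decide (a.length < x)) = b.word.map (fun x => x + a.length)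

/-- The product of `PQSym`, the bilinear map such that `F_a F_b` is the sum of all `F_c`, for `c`
in the shifted shuffle of `a` and `b`. -/
noncomputable def mulMap : PQSym R →ₗ[R] PQSym R →ₗ[R] PQSym R :=
  (basisF R).constr R fun a => (basisF R).constr R fun b => ∑ c ∈ shiftedShuffle a b, F R c

noncomputable instance : Mul (PQSym R) := ⟨fun x y => mulMap R x y⟩

/-- The unit of `PQSym` is `F` of the empty parking function. -/
noncomputable instance : One (PQSym R) := ⟨F R ⟨[], by decide⟩⟩

/-- The coproduct of `PQSym`: `Δ F_a` is the sum, over all the factorizations `a = u · v` of the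
word `a`, of `F_{Park(u)} ⊗ F_{Park(v)}`. -/
noncomputable def comul : PQSym R →ₗ[R] PQSym R ⊗[R] PQSym R :=
  (basisF R).constr R fun a => ∑ i ∈ Finset.range (a.length + 1),
    F R (Park (a.word.take i) fun x hx => a.2.1 x (List.mem_of_mem_take hx)) ⊗ₜ[R]
    F R (Park (a.word.drop i) fun x hx => a.2.1 x (List.mem_of_mem_drop hx))

/-- `P^π`, the sum of the `F_a` over all the parking functions `a` that are rearrangements of the
word `π`. -/
noncomputable def P (π : ParkingFunction) : PQSym R :=
  ∑ a ∈ (PF π.length).filter (fun a => a.word.Perm π.word), F R a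

/-- The subspace `CQSym` of `PQSym`, spanned by the `P^π`, for `π` a nondecreasing parking
function. -/
noncomputable def CQSym : Submodule R (PQSym R) :=
  Submodule.span R {x | ∃ π : ParkingFunction, π.word.Pairwise (· ≤ ·) ∧ x = P R π}

/-- `G_n`, the sum of all parking functions of length `n`. -/
noncomputable def G (n : ℕ) : PQSym R := ∑ a ∈ PF n, F R a

/-- `G^I = G_{i_1} ⋯ G_{i_r}` for `I = (i_1, …, i_r)`, with `G^I = 1` for the empty sequence. -/
noncomputable def Gpow (I : List ℕ) : PQSym R := (I.map (G R)).prod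

end PQSym

/-! ### Profiles and parking biprofiles -/

/-- The length of the longest prefix of the nondecreasing word `w = x ⋯` that is a shifted parking
function; since a nondecreasing nonempty parking function begins with `1`, the shift has to be by
`x - 1`. -/
def blockLength : List ℕ → ℕ
  | [] => 0
  | x :: l => Nat.findGreatest
      (fun c => IsParking (((x :: l).take c).map (fun y => y + 1 - x))) (l.length + 1)

theorem blockLength_pos (x : ℕ) (l : List ℕ) : 0 < blockLength (x :: l) := by
  have h : IsParking (((x :: l).take 1).map (fun y => y + 1 - x)) := by
    simp only [List.take_succ_cons, List.take_zero, List.map_cons, List.map_nil]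
    rw [show x + 1 - x = 1 by omega]
    decide
  exact Nat.le_findGreatest (P := fun c =>
    IsParking (((x :: l).take c).map (fun y => y + 1 - x))) (by omega) h

/-- The profile of a nondecreasing word `w`: the sequence of biletters `(s_i, c_i)`, where `s_i`
is the first letter and `c_i` the length of the `i`-th block `w_i` in the factorization
`w = w_1 w_2 ⋯ w_k` of `w` into shifted parking functions of maximal length. -/
def profile : List ℕ → List (ℕ × ℕ)
  | [] => []
  | x :: l =>
    (x, blockLength (x :: l)) :: profile ((x :: l).drop (blockLength (x :: l)))
termination_by w => w.length
decreasing_by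
  have := blockLength_pos x l
  simp only [List.length_drop, List.length_cons]
  omega

/-- The pairs `(u, v)` of nondecreasing words such that the concatenation `uv` is a parking
function of length `n`. -/
def parkingPairs (n : ℕ) : Set (List ℕ × List ℕ) :=
  {p | p.1.Pairwise (· ≤ ·) ∧ p.2.Pairwise (· ≤ ·) ∧ IsParking (p.1 ++ p.2) ∧
    (p.1 ++ p.2).length = n}

theorem finite_parkingPairs (n : ℕ) : (parkingPairs n).Finite := by
  refine ((finite_words n).prod (finite_words n)).subset ?_
  rintro ⟨u, v⟩ ⟨-, -, h, hn⟩
  have h' := h.le_length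
  dsimp only at h h' hn
  rw [hn] at h'
  rw [List.length_append] at hn
  exact ⟨⟨by dsimp; omega, fun x hx => h' x (List.mem_append_left _ hx)⟩,
    ⟨by dsimp; omega, fun x hx => h' x (List.mem_append_right _ hx)⟩⟩

/-- The parking biprofiles of size `n`: the biprofiles `(pf(u), pf(v))` of the pairs `(u, v)` of
nondecreasing words such that `uv` is a parking function of length `n`. -/
noncomputable def parkingBiprofiles (n : ℕ) : Finset (List (ℕ × ℕ) × List (ℕ × ℕ)) :=
  (finite_parkingPairs n).toFinset.image fun p => (profile p.1, profile p.2)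

/-- The bottom row `(c_1, …, c_k)` of a profile. -/
def bottomRow (p : List (ℕ × ℕ)) : List ℕ := p.map Prod.snd

/-! Let cars with preferred spots `w` park one after another, each in the first free spot from its
preferred one on. The set `U` of spots finally occupied does not depend on the order of the cars,
and the counting inequalities of `Occupies` determine it. It controls everything: parkization
replaces each letter by its rank in `U` (`Occupies.park_eq`); the blocks of the sorted word fill the
maximal runs of consecutive spots of `U`, so that the profile and `U` carry the same information
(`profile_spec`, `IsProfileAbove.cells_injective`); and whether `uv` is a parking function depends
only on the two occupied sets, through a ballot condition (`isParking_append_iff`).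

The coproduct of `G n` is a sum over all pairs `(u, v)` with `uv` a parking function of length `n`.
Grouped by pairs of occupied sets, it becomes a sum of tensor products of full sums over the words
occupying a given set. Ranking sends the words occupying `cells p` bijectively to the parking
functions that have exactly `t` letters at most `t` for each partial sum `t` of the bottom row
(`sum_parkF`). Unfolding the shifted shuffles shows that the product of the `G` along the bottom row
is the sum of those same parking functions (`Gpow_eq_sum`). This description is invariant under
rearrangement, whence membership in `CQSym`.

Finally, biprofiles correspond to ballot pairs of subsets of `{1, ..., n}`. Reading off how many of
the two sets contain `i`, minus one, gives nonnegative walks from 0 to 0 with steps +1, 0 (in two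
colours) and -1, which a binomial difference counts (`ballotCount_add_choose`). -/

/-- The number of elements of `U` that are at most `j`. -/
def cardLE (U : Finset ℕ) (j : ℕ) : ℕ := (U.filter (· ≤ j)).card

/-- The number of letters of `w` that are at most `j`. -/
def countLE (w : List ℕ) (j : ℕ) : ℕ := w.countP (fun x => decide (x ≤ j))

/-! ### Counting functions of sets and words. -/

theorem cardLE_succ (U : Finset ℕ) (j : ℕ) :
    cardLE U (j + 1) = cardLE U j + if j + 1 ∈ U then 1 else 0 := by
  unfold cardLE
  split_ifs with h
  · have : U.filter (· ≤ j + 1) = insert (j + 1) (U.filter (· ≤ j)) := by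
      ext x; simp only [Finset.mem_filter, Finset.mem_insert]
      constructor
      · rintro ⟨h1, h2⟩
        by_cases hx : x = j + 1
        · exact Or.inl hx
        · exact Or.inr ⟨h1, by omega⟩
      · rintro (rfl | ⟨h1, h2⟩)
        · exact ⟨h, le_rfl⟩
        · exact ⟨h1, by omega⟩
    rw [this, Finset.card_insert_of_notMem (by simp)]
  · congr 1
    ext x; simp only [Finset.mem_filter]
    constructor
    · rintro ⟨h1, h2⟩
      refine ⟨h1, ?_⟩
      rcases Nat.lt_or_eq_of_le h2 with h3 | rfl
      · omega
      · exact absurd h1 h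
    · rintro ⟨h1, h2⟩
      exact ⟨h1, by omega⟩

theorem cardLE_mono (U : Finset ℕ) : Monotone (cardLE U) := fun _ _ h =>
  Finset.card_le_card fun x hx => by
    simp only [Finset.mem_filter] at hx ⊢; exact ⟨hx.1, hx.2.trans h⟩

theorem cardLE_lt {U : Finset ℕ} {x j : ℕ} (hx : x ∈ U) (h : j < x) :
    cardLE U j < cardLE U x := by
  obtain ⟨y, rfl⟩ : ∃ y, x = y + 1 := ⟨x - 1, by omega⟩
  rw [cardLE_succ, if_pos hx]
  have := cardLE_mono U (show j ≤ y by omega)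
  omega

theorem cardLE_le_iff {U : Finset ℕ} {x j : ℕ} (hx : x ∈ U) :
    cardLE U x ≤ cardLE U j ↔ x ≤ j :=
  ⟨fun h => by by_contra! h'; exact absurd (cardLE_lt hx h') (by omega),
    fun h => cardLE_mono U h⟩

theorem cardLE_injOn (U : Finset ℕ) : Set.InjOn (cardLE U) (U : Set ℕ) := fun _ hx _ hy h =>
  le_antisymm ((cardLE_le_iff hx).1 h.le) ((cardLE_le_iff hy).1 h.ge)

theorem cardLE_zero {U : Finset ℕ} (h : 0 ∉ U) : cardLE U 0 = 0 := by
  unfold cardLE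
  rw [Finset.card_eq_zero, Finset.filter_eq_empty_iff]
  intro x hx hx0
  exact h (by rwa [Nat.le_zero.1 hx0] at hx)

theorem cardLE_le_card (U : Finset ℕ) (j : ℕ) : cardLE U j ≤ U.card := Finset.card_filter_le _ _

theorem cardLE_eq_card {U : Finset ℕ} {j : ℕ} (h : ∀ x ∈ U, x ≤ j) : cardLE U j = U.card := by
  unfold cardLE; rw [Finset.filter_true_of_mem h]

theorem cardLE_le {U : Finset ℕ} (h : 0 ∉ U) (j : ℕ) : cardLE U j ≤ j := by
  induction j with
  | zero => rw [cardLE_zero h]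
  | succ j ih => rw [cardLE_succ]; split_ifs <;> omega

theorem cardLE_lt_of_notMem {U : Finset ℕ} (h : 0 ∉ U) {i j : ℕ} (hij : i ≤ j) (hi : 1 ≤ i)
    (hiU : i ∉ U) : cardLE U j < j := by
  induction j, hij using Nat.le_induction with
  | base =>
    obtain ⟨y, rfl⟩ : ∃ y, i = y + 1 := ⟨i - 1, by omega⟩
    rw [cardLE_succ, if_neg hiU]
    have := cardLE_le h y
    omega
  | succ j _ ih => rw [cardLE_succ]; split_ifs <;> omega

theorem cardLE_union {U V : Finset ℕ} (h : Disjoint U V) (j : ℕ) :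
    cardLE (U ∪ V) j = cardLE U j + cardLE V j := by
  unfold cardLE
  rw [Finset.filter_union, Finset.card_union_of_disjoint (Finset.disjoint_filter_filter h)]

/-- The counting function climbs from 0 to `U.card` by unit steps; the first `j` at which it reaches
`k ≥ 1` is a place where it jumps, hence a point of `U`. -/
theorem cardLE_surj {U : Finset ℕ} (h : 0 ∉ U) {k : ℕ} (hk : k ≤ U.card) :
    ∃ j, cardLE U j = k ∧ (1 ≤ k → j ∈ U) := by
  have hex : ∃ j, k ≤ cardLE U j :=
    ⟨U.sup id, by rwa [cardLE_eq_card fun x hx => Finset.le_sup (f := id) hx]⟩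
  have hs := Nat.find_spec hex
  rcases hm : Nat.find hex with _ | m
  · rw [hm, cardLE_zero h] at hs
    exact ⟨0, by rw [cardLE_zero h]; omega, fun _ => by omega⟩
  · have hlt := Nat.find_min hex (m := m) (by omega)
    rw [hm, cardLE_succ] at hs
    by_cases hmU : m + 1 ∈ U
    · refine ⟨m + 1, ?_, fun _ => hmU⟩
      rw [if_pos hmU] at hs
      rw [cardLE_succ, if_pos hmU]
      omega
    · rw [if_neg hmU] at hs
      omega

theorem cardLE_Ico (s c j : ℕ) : cardLE (Finset.Ico s (s + c)) j = min c (j + 1 - s) := by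
  have : (Finset.Ico s (s + c)).filter (· ≤ j) = Finset.Ico s (min (s + c) (j + 1)) := by
    ext x; simp only [Finset.mem_filter, Finset.mem_Ico, lt_min_iff]; omega
  rw [cardLE, this, Nat.card_Ico]; omega

theorem countLE_append (u v : List ℕ) (j : ℕ) : countLE (u ++ v) j = countLE u j + countLE v j :=
  List.countP_append

theorem countLE_succ (w : List ℕ) (j : ℕ) :
    countLE w (j + 1) = countLE w j + w.count (j + 1) := by
  induction w with
  | nil => rfl
  | cons x w ih =>
    simp only [countLE, List.countP_cons, List.count_cons, decide_eq_true_eq, beq_iff_eq] at ih ⊢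
    rw [ih]
    split_ifs <;> omega

theorem countLE_eq_length {w : List ℕ} {j : ℕ} (h : ∀ x ∈ w, x ≤ j) : countLE w j = w.length :=
  List.countP_eq_length.2 (by simpa using h)

theorem countLE_zero {w : List ℕ} (h : ∀ x ∈ w, 1 ≤ x) : countLE w 0 = 0 :=
  List.countP_eq_zero.2 fun x hx => by have := h x hx; simp; omega

theorem List.Perm.countLE_eq {u v : List ℕ} (h : u.Perm v) (j : ℕ) : countLE u j = countLE v j :=
  h.countP_eq _

theorem isParking_iff {w : List ℕ} :
    IsParking w ↔ (∀ x ∈ w, 1 ≤ x) ∧ ∀ i ≤ w.length, i ≤ countLE w i := Iff.rfl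

theorem List.Perm.isParking {u v : List ℕ} (h : u.Perm v) (hu : IsParking u) : IsParking v :=
  isParking_iff.2 ⟨fun x hx => hu.1 x (h.mem_iff.2 hx), fun i hi => by
    rw [← h.countLE_eq]; exact hu.2 i (by rwa [h.length_eq])⟩

/-! ### Occupied spots. -/

/-- The spots of `U` are those occupied once cars with preferred spots `w` have parked, each in
the first free spot from its preferred one on: at most as many spots of `U` as letters of `w` lie
in `{1, ..., j}`, with equality when `j` is free. -/
def Occupies (w : List ℕ) (U : Finset ℕ) : Prop :=
  0 ∉ U ∧ ∀ j, cardLE U j ≤ countLE w j ∧ (j ∉ U → countLE w j = cardLE U j)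

namespace Occupies

variable {u v w : List ℕ} {U V : Finset ℕ}

theorem perm (h : Occupies u U) (huv : u.Perm v) : Occupies v U :=
  ⟨h.1, fun j => by rw [← huv.countLE_eq]; exact h.2 j⟩

theorem le (h : Occupies w U) (j : ℕ) : cardLE U j ≤ countLE w j := (h.2 j).1

theorem eq (h : Occupies w U) {j : ℕ} (hj : j ∉ U) : countLE w j = cardLE U j := (h.2 j).2 hj

/-- A car whose preferred spot stayed free would have parked there: from `x - 1` to a free `x` the
set count is constant, while a letter `x` would push the word count above it. -/
theorem mem (h : Occupies w U) {x : ℕ} (hx : x ∈ w) : x ∈ U := by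
  by_contra hxU
  have h1 := h.eq hxU
  rcases x with _ | x
  · rw [cardLE_zero h.1] at h1
    have := List.countP_eq_zero.1 h1 0 hx
    simp at this
  · rw [cardLE_succ, if_neg hxU, countLE_succ] at h1
    have h2 := h.le x
    have h3 := List.count_pos_iff.2 hx
    omega

theorem one_le (h : Occupies w U) {x : ℕ} (hx : x ∈ w) : 1 ≤ x :=
  Nat.one_le_iff_ne_zero.2 fun h0 => h.1 (h0 ▸ h.mem hx)

theorem length_eq (h : Occupies w U) : w.length = U.card := by
  have hle : ∀ x ∈ U, x ≤ U.sup id := fun x hx => Finset.le_sup (f := id) hx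
  have h1 : U.sup id + 1 ∉ U := fun hm => by have := hle _ hm; omega
  have h2 := h.eq h1
  rwa [cardLE_eq_card fun x hx => (hle x hx).trans (Nat.le_succ _),
    countLE_eq_length fun x hx => (hle x (h.mem hx)).trans (Nat.le_succ _)] at h2

/-- Induction on spots: if the sets agree up to `j` and only `U` contains `j + 1`, then `w` has more
letters up to `j + 1` than equality at the free spot of `V` permits. -/
theorem unique (hU : Occupies w U) (hV : Occupies w V) : U = V := by
  have key : ∀ j, cardLE U j = cardLE V j ∧ (j ∈ U ↔ j ∈ V) := by
    intro j
    induction j with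
    | zero => simp [cardLE_zero hU.1, cardLE_zero hV.1, hU.1, hV.1]
    | succ j ih =>
      have a1 := hU.2 (j + 1)
      have a2 := hV.2 (j + 1)
      simp only [cardLE_succ] at a1 a2 ⊢
      by_cases h1 : j + 1 ∈ U <;> by_cases h2 : j + 1 ∈ V <;> simp [h1, h2] at a1 a2 ⊢ <;> omega
  ext j
  exact (key j).2

theorem append (hU : Occupies u U) (hV : Occupies v V) (h : Disjoint U V) :
    Occupies (u ++ v) (U ∪ V) := by
  refine ⟨by simp [hU.1, hV.1], fun j => ?_⟩
  rw [cardLE_union h, countLE_append]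
  refine ⟨Nat.add_le_add (hU.le j) (hV.le j), fun hj => ?_⟩
  rw [Finset.mem_union, not_or] at hj
  rw [hU.eq hj.1, hV.eq hj.2]

end Occupies

theorem IsParking.occupies {w : List ℕ} (h : IsParking w) :
    Occupies w (Finset.Ico 1 (1 + w.length)) := by
  refine ⟨by simp, fun j => ?_⟩
  rw [cardLE_Ico]
  by_cases hj : j ≤ w.length
  · have : j ≤ countLE w j := h.2 j hj
    refine ⟨by omega, fun hj' => ?_⟩
    rw [Finset.mem_Ico] at hj'
    obtain rfl : j = 0 := by omega
    rw [countLE_zero h.1]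
    omega
  · rw [countLE_eq_length fun x hx => by have := h.le_length x hx; omega]
    omega

/-- Cars with distinct preferences all get their spots. Thus every set without 0 is an occupied set,
which gives surjectivity when biprofiles are counted. -/
theorem occupies_sort {U : Finset ℕ} (h : 0 ∉ U) : Occupies (U.sort (· ≤ ·)) U := by
  have key : ∀ j, countLE (U.sort (· ≤ ·)) j = cardLE U j := fun j => by
    rw [countLE, List.countP_eq_length_filter, cardLE,
      ← List.toFinset_card_of_nodup ((U.sort_nodup _).filter _)]
    congr 1
    ext x; simp
  exact ⟨h, fun j => ⟨(key j).ge, fun _ => key j⟩⟩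

/-! ### Parkization in terms of occupied spots -/

theorem Occupies.parkStep_spec {w : List ℕ} {U : Finset ℕ} (h : Occupies w U) :
    parkD w ∉ U ∧ Occupies (parkStep w) (U.image fun x => if parkD w < x then x - 1 else x) ∧
    ∀ j, cardLE (U.image fun x => if parkD w < x then x - 1 else x) j =
      if j < parkD w then cardLE U j else cardLE U (j + 1) := by
  have hlt : countLE w (parkD w) < parkD w := Nat.find_spec (exists_countP_lt w)
  have hmin : ∀ i < parkD w, i ≤ countLE w i := fun i hi =>
    not_lt.1 (Nat.find_min (exists_countP_lt w) hi)
  generalize hdd : parkD w = d at *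
  -- If `d` were occupied, fewer than `d - 1` of the spots before it would be, so some earlier spot
  -- `i ≥ 1` would be free; there the word count equals the set count, which is less than `i`,
  -- against minimality of `d`.
  have hd : d ∉ U := by
    intro hdU
    obtain ⟨e, rfl⟩ : ∃ e, d = e + 1 := ⟨d - 1, by omega⟩
    have h1 := h.le (e + 1)
    rw [cardLE_succ, if_pos hdU] at h1
    have h2 : cardLE U e < e := by omega
    have h3 : ∃ i, 1 ≤ i ∧ i ≤ e ∧ i ∉ U := by
      by_contra! hcon
      have : Finset.Icc 1 e ⊆ U.filter (· ≤ e) := fun x hx => by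
        rw [Finset.mem_Icc] at hx
        exact Finset.mem_filter.2 ⟨hcon x hx.1 hx.2, hx.2⟩
      have := Finset.card_le_card this
      rw [Nat.card_Icc] at this
      unfold cardLE at h2
      omega
    obtain ⟨i, hi1, hie, hiU⟩ := h3
    have h4 := hmin i (by omega)
    rw [h.eq hiU] at h4
    exact absurd (cardLE_lt_of_notMem h.1 le_rfl hi1 hiU) (by omega)
  have hcard : ∀ j, cardLE (U.image fun x => if d < x then x - 1 else x) j =
      if j < d then cardLE U j else cardLE U (j + 1) := by
    intro j
    -- Only `d` and `d + 1` are identified, and `d` is free.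
    have hinj : Set.InjOn (fun x => if d < x then x - 1 else x) (U : Set ℕ) := by
      intro x hx y hy hxy
      have hxd : x ≠ d := fun e => hd (e ▸ hx)
      have hyd : y ≠ d := fun e => hd (e ▸ hy)
      dsimp only at hxy
      split_ifs at hxy <;> omega
    unfold cardLE
    rw [Finset.filter_image, Finset.card_image_of_injOn
      (hinj.mono fun x hx => (Finset.mem_filter.1 hx).1)]
    split_ifs with hj
    · congr 1
      refine Finset.filter_congr fun x hx => ?_
      split_ifs <;> omega
    · congr 1
      refine Finset.filter_congr fun x hx => ?_
      split_ifs <;> omega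
  refine ⟨hd, ⟨?_, fun j => ?_⟩, hcard⟩
  · rw [Finset.mem_image]
    rintro ⟨x, hx, hx0⟩
    split_ifs at hx0 with hdx
    · omega
    · exact h.1 (hx0 ▸ hx)
  · have hcount : countLE (parkStep w) j = if j < d then countLE w j else countLE w (j + 1) := by
      rw [parkStep, countLE, List.countP_map, hdd]
      have hxd : ∀ x ∈ w, x ≠ d := fun x hx e => hd (e ▸ h.mem hx)
      split_ifs with hj
      · refine List.countP_congr fun x hx => ?_
        have := hxd x hx
        simp only [Function.comp, decide_eq_true_eq]
        split_ifs <;> omega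
      · refine List.countP_congr fun x hx => ?_
        have := hxd x hx
        simp only [Function.comp, decide_eq_true_eq]
        split_ifs <;> omega
    rw [hcard, hcount]
    refine ⟨by split_ifs; exacts [h.le _, h.le _], fun hj => ?_⟩
    split_ifs with hjd
    · refine h.eq fun hjU => hj (Finset.mem_image.2 ⟨j, hjU, ?_⟩)
      rw [if_neg (by omega)]
    · refine h.eq fun hjU => hj (Finset.mem_image.2 ⟨j + 1, hjU, ?_⟩)
      rw [if_pos (by omega), Nat.add_sub_cancel]

/-- Each step deletes a free spot, which leaves the ranks of the occupied ones unchanged; at the end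
the occupied set is `{1, ..., |w|}`, where rank is the identity. -/
theorem Occupies.park_eq {w : List ℕ} {U : Finset ℕ} (h : Occupies w U) :
    park w = w.map (cardLE U) := by
  fun_induction park w generalizing U with
  | case1 w hw =>
    have hp : IsParking w := ⟨fun x hx => h.one_le hx, hw⟩
    have hU := h.unique hp.occupies
    conv_lhs => rw [← List.map_id w]
    refine List.map_congr_left fun x hx => ?_
    have := hp.le_length x hx
    rw [hU, cardLE_Ico, id]
    omega
  | case2 w hw ih =>
    obtain ⟨hd, h1, h2⟩ := h.parkStep_spec
    rw [ih h1, parkStep, List.map_map]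
    refine List.map_congr_left fun x hx => ?_
    have hxd : x ≠ parkD w := fun e => hd (e ▸ h.mem hx)
    rw [Function.comp, h2]
    by_cases hx1 : parkD w < x
    · rw [if_pos hx1, if_neg (by omega), Nat.sub_add_cancel (by omega)]
    · rw [if_neg hx1, if_pos (by omega)]

/-! ### Profiles -/

/-- The union of the intervals `{s, ..., s + c - 1}`, for the biletters `(s, c)` of `p`. -/
def cells : List (ℕ × ℕ) → Finset ℕ
  | [] => ∅
  | b :: p => Finset.Ico b.1 (b.1 + b.2) ∪ cells p

/-- The intervals of `p` are nonempty, and each begins after the first position that follows the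
previous one; the first begins after `lo`. -/
def IsProfileAbove : ℕ → List (ℕ × ℕ) → Prop
  | _, [] => True
  | lo, b :: p => lo < b.1 ∧ 0 < b.2 ∧ IsProfileAbove (b.1 + b.2) p

theorem IsProfileAbove.lt_of_mem_cells {lo : ℕ} {p : List (ℕ × ℕ)} (h : IsProfileAbove lo p) :
    ∀ x ∈ cells p, lo < x := by
  induction p generalizing lo with
  | nil => simp [cells]
  | cons b p ih =>
    obtain ⟨h1, h2, h3⟩ := h
    intro x hx
    rcases Finset.mem_union.1 hx with hx | hx
    · rw [Finset.mem_Ico] at hx; omega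
    · have := ih h3 x hx; omega

theorem IsProfileAbove.disjoint {s c : ℕ} {p : List (ℕ × ℕ)} (h : IsProfileAbove (s + c) p) :
    Disjoint (Finset.Ico s (s + c)) (cells p) :=
  Finset.disjoint_left.2 fun x hx hx' => by
    have := h.lt_of_mem_cells x hx'
    rw [Finset.mem_Ico] at hx
    omega

/-- The intervals are separated by gaps, so they are the maximal runs of the set: the first starts
at the minimum and ends just before the first missing spot after it. -/
theorem IsProfileAbove.cells_injective {lo lo' : ℕ} {p q : List (ℕ × ℕ)}
    (hp : IsProfileAbove lo p) (hq : IsProfileAbove lo' q) (h : cells p = cells q) : p = q := by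
  induction p generalizing lo lo' q with
  | nil =>
    rcases q with _ | ⟨b, q⟩
    · rfl
    · have : b.1 ∈ cells (b :: q) :=
        Finset.mem_union_left _ (Finset.mem_Ico.2 ⟨le_rfl, by have := hq.2.1; omega⟩)
      exact absurd (h ▸ this) (Finset.notMem_empty _)
  | cons a p ih =>
    rcases q with _ | ⟨b, q⟩
    · have : a.1 ∈ cells (a :: p) :=
        Finset.mem_union_left _ (Finset.mem_Ico.2 ⟨le_rfl, by have := hp.2.1; omega⟩)
      exact absurd (h ▸ this) (Finset.notMem_empty _)
    · obtain ⟨s, c⟩ := a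
      obtain ⟨t, d⟩ := b
      obtain ⟨-, hp1, hp2⟩ := hp
      obtain ⟨-, hq1, hq2⟩ := hq
      have key : ∀ x, (s ≤ x ∧ x < s + c) ∨ x ∈ cells p ↔ (t ≤ x ∧ x < t + d) ∨ x ∈ cells q :=
        fun x => by simpa [cells] using Finset.ext_iff.1 h x
      have hp3 := hp2.lt_of_mem_cells
      have hq3 := hq2.lt_of_mem_cells
      dsimp only at *
      have e1 : s = t := by
        refine le_antisymm ?_ ?_
        · rcases (key t).2 (Or.inl (by omega)) with h1 | h1
          · omega
          · have := hp3 _ h1; omega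
        · rcases (key s).1 (Or.inl (by omega)) with h1 | h1
          · omega
          · have := hq3 _ h1; omega
      subst e1
      have e2 : c = d := by
        refine le_antisymm ?_ ?_
        · by_contra! hlt
          rcases (key (s + d)).1 (Or.inl (by omega)) with h1 | h1
          · omega
          · have := hq3 _ h1; omega
        · by_contra! hlt
          rcases (key (s + c)).2 (Or.inl (by omega)) with h1 | h1
          · omega
          · have := hp3 _ h1; omega
      subst e2
      rw [ih hp2 hq2]
      ext x
      constructor <;> intro hx
      · rcases (key x).1 (Or.inr hx) with h1 | h1
        · have := hp3 _ hx; omega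
        · exact h1
      · rcases (key x).2 (Or.inr hx) with h1 | h1
        · have := hq3 _ hx; omega
        · exact h1

theorem occupies_of_shift {w : List ℕ} {s : ℕ} (hs : 1 ≤ s)
    (h : IsParking (w.map fun y => y + 1 - s)) :
    Occupies w (Finset.Ico s (s + w.length)) := by
  have hw : ∀ y ∈ w, s ≤ y := fun y hy => by
    have := h.1 _ (List.mem_map_of_mem hy); omega
  refine ⟨by simp; omega, fun j => ?_⟩
  -- All letters are at least `s`, so the truncated subtraction is harmless: for `j < s` both counts
  -- are 0.
  have hc : countLE w j = countLE (w.map fun y => y + 1 - s) (j + 1 - s) := by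
    rw [countLE, countLE, List.countP_map]
    refine List.countP_congr fun y hy => ?_
    have := hw y hy
    simp only [Function.comp, decide_eq_true_eq]
    omega
  have h1 := h.occupies.2 (j + 1 - s)
  rw [cardLE_Ico, List.length_map, Finset.mem_Ico] at h1
  rw [cardLE_Ico, hc, Finset.mem_Ico]
  exact ⟨by omega, fun hj => by rw [h1.2 (by omega)]; omega⟩

theorem blockLength_spec (x : ℕ) (l : List ℕ) :
    blockLength (x :: l) ≤ l.length + 1 ∧
    IsParking (((x :: l).take (blockLength (x :: l))).map (fun y => y + 1 - x)) := by
  have h := Nat.findGreatest_spec (P := fun c =>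
    IsParking (((x :: l).take c).map (fun y => y + 1 - x))) (n := l.length + 1) (m := 0)
    (Nat.zero_le _) (by simp; decide)
  exact ⟨Nat.findGreatest_le _, h⟩

/-- Greediness creates the gap: a next letter at most `x + c`, with `c` the block length, becomes at
most `c + 1` after shifting, and appending it would give a longer shifted parking function. -/
theorem lt_of_mem_drop_blockLength {x : ℕ} {l : List ℕ} (h : (x :: l).Pairwise (· ≤ ·)) :
    ∀ y ∈ (x :: l).drop (blockLength (x :: l)), x + blockLength (x :: l) < y := by
  obtain ⟨h1, h2⟩ := blockLength_spec x l
  have h3 : ∀ c, blockLength (x :: l) < c → c ≤ l.length + 1 →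
      ¬ IsParking (((x :: l).take c).map (fun y => y + 1 - x)) := fun c hc hc' =>
    Nat.findGreatest_is_greatest hc hc'
  have hx : ∀ y ∈ x :: l, x ≤ y := by
    intro y hy
    rcases List.mem_cons.1 hy with rfl | hy
    · exact le_rfl
    · exact List.rel_of_pairwise_cons h hy
  generalize blockLength (x :: l) = c at *
  generalize hw : x :: l = w at *
  have hlen : w.length = l.length + 1 := by rw [← hw]; rfl
  rcases hD : w.drop c with _ | ⟨z, t⟩
  · simp
  have hdrop : (z :: t).Pairwise (· ≤ ·) := hD ▸ h.sublist (List.drop_sublist _ _)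
  have hclt : c < w.length := by
    by_contra! hcon
    rw [List.drop_eq_nil_of_le hcon] at hD
    cases hD
  have hz : x + c < z := by
    by_contra! hz
    refine h3 (c + 1) (by omega) (by omega) ?_
    have htake : w.take (c + 1) = w.take c ++ [z] := by
      rw [List.take_add, hD]; rfl
    rw [htake, List.map_append]
    have hzx : x ≤ z := hx z (List.mem_of_mem_drop (hD ▸ List.mem_cons_self))
    refine isParking_iff.2 ⟨fun y hy => ?_, fun i hi => ?_⟩
    · rcases List.mem_append.1 hy with hy | hy
      · exact h2.1 y hy
      · simp only [List.map_cons, List.map_nil, List.mem_singleton] at hy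
        omega
    · have hl : (List.map (fun y => y + 1 - x) (w.take c)).length = c := by
        rw [List.length_map, List.length_take]; omega
      rw [List.length_append, hl] at hi
      simp only [List.map_cons, List.map_nil, List.length_cons, List.length_nil] at hi
      rw [countLE_append]
      rcases Nat.lt_or_ge c i with hci | hci
      · have e : i = c + 1 := by omega
        subst e
        rw [countLE_eq_length fun y hy => by have := h2.le_length y hy; omega, hl,
          countLE_eq_length fun y hy => by
            simp only [List.map_cons, List.map_nil, List.mem_singleton] at hy; omega]
        simp
      · exact (h2.2 i (by omega)).trans (Nat.le_add_right _ _)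
  intro y hy
  rcases List.mem_cons.1 hy with rfl | hy
  · exact hz
  · exact hz.trans_le (List.rel_of_pairwise_cons hdrop hy)

/-- Each block fills its own interval, and the gaps make the intervals disjoint. The bound `lo`
carries the gap through the induction. -/
theorem profile_spec (w : List ℕ) (h : w.Pairwise (· ≤ ·)) (lo : ℕ) (hlo : ∀ y ∈ w, lo < y) :
    IsProfileAbove lo (profile w) ∧ Occupies w (cells (profile w)) := by
  fun_induction profile w generalizing lo with
  | case1 => exact ⟨trivial, by simp [cells], fun j => by simp [cells, cardLE, countLE]⟩
  | case2 x l ih =>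
    obtain ⟨h1, h2⟩ := blockLength_spec x l
    obtain ⟨h3, h4⟩ := ih (h.sublist (List.drop_sublist _ _)) _ (lt_of_mem_drop_blockLength h)
    have hx := hlo x List.mem_cons_self
    refine ⟨⟨hx, blockLength_pos x l, h3⟩, ?_⟩
    have h5 := occupies_of_shift (by omega) h2
    rw [List.length_take, List.length_cons, Nat.min_eq_left h1] at h5
    have := h5.append h4 h3.disjoint
    rwa [List.take_append_drop] at this

/-- The profile of the nondecreasing rearrangement of `w`. -/
def sortedProfile (w : List ℕ) : List (ℕ × ℕ) := profile (w.insertionSort (· ≤ ·))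

theorem sortedProfile_spec {w : List ℕ} (h : ∀ x ∈ w, 1 ≤ x) :
    IsProfileAbove 0 (sortedProfile w) ∧ Occupies w (cells (sortedProfile w)) := by
  have hp := List.perm_insertionSort (· ≤ ·) w
  have h1 := profile_spec _ (List.pairwise_insertionSort (· ≤ ·) w) 0
    fun y hy => h y (hp.mem_iff.1 hy)
  exact ⟨h1.1, h1.2.perm hp⟩

theorem sortedProfile_eq_iff {w : List ℕ} (h : ∀ x ∈ w, 1 ≤ x) {p : List (ℕ × ℕ)}
    (hp : IsProfileAbove 0 p) : sortedProfile w = p ↔ Occupies w (cells p) := by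
  obtain ⟨h1, h2⟩ := sortedProfile_spec h
  exact ⟨fun e => e ▸ h2, fun h3 => h1.cells_injective hp (h2.unique h3)⟩

theorem card_cells {lo : ℕ} {p : List (ℕ × ℕ)} (h : IsProfileAbove lo p) :
    (cells p).card = (bottomRow p).sum := by
  induction p generalizing lo with
  | nil => rfl
  | cons b p ih =>
    rw [cells, Finset.card_union_of_disjoint h.2.2.disjoint, ih h.2.2, Nat.card_Ico]
    simp only [bottomRow, List.map_cons, List.sum_cons]
    omega

/-- The number of occupied cells below a free one is a partial sum of the bottom row. -/
theorem exists_prefix_of_notMem {lo : ℕ} {p : List (ℕ × ℕ)} (h : IsProfileAbove lo p) {j : ℕ}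
    (hj : j ∉ cells p) : ∃ J, J <+: bottomRow p ∧ cardLE (cells p) j = J.sum := by
  induction p generalizing lo with
  | nil => exact ⟨[], List.nil_prefix, rfl⟩
  | cons b p ih =>
    rw [cells, Finset.mem_union, not_or, Finset.mem_Ico] at hj
    rw [cells, cardLE_union h.2.2.disjoint, cardLE_Ico]
    rcases Nat.lt_or_ge j b.1 with hlt | hge
    · refine ⟨[], List.nil_prefix, ?_⟩
      have : cardLE (cells p) j = 0 := by
        unfold cardLE
        rw [Finset.card_eq_zero, Finset.filter_eq_empty_iff]
        intro x hx
        have := h.2.2.lt_of_mem_cells x hx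
        omega
      rw [this, List.sum_nil]
      omega
    · obtain ⟨J, hJ, e⟩ := ih h.2.2 hj.2
      refine ⟨b.2 :: J, List.prefix_cons_iff.2 (Or.inr ⟨J, rfl, hJ⟩), ?_⟩
      rw [e, List.sum_cons]
      omega

/-- The free spot is the one just after the last interval of the prefix, or `lo` for the empty
prefix. -/
theorem exists_notMem_of_prefix {lo : ℕ} {p : List (ℕ × ℕ)} (h : IsProfileAbove lo p)
    {J : List ℕ} (hJ : J <+: bottomRow p) :
    ∃ j ≥ lo, j ∉ cells p ∧ cardLE (cells p) j = J.sum := by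
  induction p generalizing lo J with
  | nil =>
    obtain rfl := List.prefix_nil.1 hJ
    exact ⟨lo, le_rfl, by simp [cells], rfl⟩
  | cons b p ih =>
    rcases List.prefix_cons_iff.1 hJ with rfl | ⟨J, rfl, hJ'⟩
    · refine ⟨lo, le_rfl, fun hm => absurd (h.lt_of_mem_cells _ hm) (lt_irrefl _), ?_⟩
      unfold cardLE
      rw [List.sum_nil, Finset.card_eq_zero, Finset.filter_eq_empty_iff]
      intro x hx
      have := h.lt_of_mem_cells x hx
      omega
    · obtain ⟨j, hj, hjm, e⟩ := ih h.2.2 hJ'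
      have := h.1
      refine ⟨j, by omega, ?_, ?_⟩
      · rw [cells, Finset.mem_union, not_or, Finset.mem_Ico]
        exact ⟨by omega, hjm⟩
      · rw [cells, cardLE_union h.2.2.disjoint, cardLE_Ico, e, List.sum_cons]
        omega

/-! ### Pairs of sets of occupied spots -/

/-- The condition on `(U, V)` for the concatenation of words that occupy `U` and `V` to be a
parking function of length `n`. -/
def IsBallot (n : ℕ) (U V : Finset ℕ) : Prop :=
  (∀ i ≤ n, i ≤ cardLE U i + cardLE V i) ∧ U.card + V.card = n

/-- Word counts dominate set counts, so the ballot condition suffices. Conversely, go up by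
induction: an occupied spot raises the set counts by at least one, and at a spot free in both sets
the two kinds of counts agree. -/
theorem isParking_append_iff {u v : List ℕ} {U V : Finset ℕ} {n : ℕ} (hu : Occupies u U)
    (hv : Occupies v V) : IsParking (u ++ v) ∧ (u ++ v).length = n ↔ IsBallot n U V := by
  rw [isParking_iff, List.length_append, hu.length_eq, hv.length_eq, IsBallot]
  constructor
  · rintro ⟨⟨-, h⟩, rfl⟩
    refine ⟨fun i => ?_, rfl⟩
    induction i with
    | zero => omega
    | succ i ih =>
      intro hi
      have h1 := ih (by omega)
      have h2 := h (i + 1) hi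
      rw [countLE_append] at h2
      by_cases hU : i + 1 ∈ U
      · rw [cardLE_succ, if_pos hU, cardLE_succ]; omega
      by_cases hV : i + 1 ∈ V
      · rw [cardLE_succ, cardLE_succ V, if_pos hV]; omega
      rwa [hu.eq hU, hv.eq hV] at h2
  · rintro ⟨h, rfl⟩
    refine ⟨⟨fun x hx => ?_, fun i hi => ?_⟩, rfl⟩
    · rcases List.mem_append.1 hx with hx | hx
      · exact hu.one_le hx
      · exact hv.one_le hx
    · rw [countLE_append]
      exact (h i hi).trans (Nat.add_le_add (hu.le i) (hv.le i))

theorem IsBallot.subset {n : ℕ} {U V : Finset ℕ} (h : IsBallot n U V) (hU : 0 ∉ U)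
    (hV : 0 ∉ V) : U ⊆ Finset.Icc 1 n ∧ V ⊆ Finset.Icc 1 n := by
  have h1 := h.1 n le_rfl
  have h2 := cardLE_le_card U n
  have h3 := cardLE_le_card V n
  have h4 := h.2
  have key : ∀ W : Finset ℕ, 0 ∉ W → cardLE W n = W.card → W ⊆ Finset.Icc 1 n := by
    intro W hW e x hx
    refine Finset.mem_Icc.2 ⟨Nat.one_le_iff_ne_zero.2 fun h0 => hW (h0 ▸ hx), ?_⟩
    have := Finset.filter_card_eq e x hx
    exact this
  exact ⟨key U hU (by omega), key V hV (by omega)⟩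

/-! ### Ballot pairs as two-coloured Motzkin paths. -/

open Classical in
/-- The number of pairs of subsets of `{1, ..., n}` that satisfy the ballot condition up to `n`
and have `n + h` elements in all. -/
noncomputable def ballotCount (n h : ℕ) : ℕ :=
  ∑ U ∈ (Finset.Icc 1 n).powerset, ∑ V ∈ (Finset.Icc 1 n).powerset,
    if (∀ i ≤ n, i ≤ cardLE U i + cardLE V i) ∧ U.card + V.card = n + h then 1 else 0

theorem cardLE_insert_of_lt (U : Finset ℕ) {i m : ℕ} (h : i < m) :
    cardLE (insert m U) i = cardLE U i := by
  unfold cardLE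
  rw [Finset.filter_insert, if_neg (by omega)]

/-- Here `k` is the height of the walk before the last step and `h` the height after it. The
condition at `n + 1` follows from the total count, because `h ≥ 0`. -/
theorem ballot_succ_iff {n h k : ℕ} {U V U' V' : Finset ℕ}
    (hU : U ⊆ Finset.Icc 1 n) (hV : V ⊆ Finset.Icc 1 n)
    (hU' : U' = U ∨ U' = insert (n + 1) U) (hV' : V' = V ∨ V' = insert (n + 1) V)
    (hc : U'.card + V'.card + k = U.card + V.card + h + 1) :
    ((∀ i ≤ n + 1, i ≤ cardLE U' i + cardLE V' i) ∧ U'.card + V'.card = n + 1 + h) ↔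
    ((∀ i ≤ n, i ≤ cardLE U i + cardLE V i) ∧ U.card + V.card = n + k) := by
  have e : ∀ i ≤ n, cardLE U' i = cardLE U i ∧ cardLE V' i = cardLE V i := by
    intro i hi
    constructor
    · rcases hU' with rfl | rfl
      · rfl
      · exact cardLE_insert_of_lt _ (by omega)
    · rcases hV' with rfl | rfl
      · rfl
      · exact cardLE_insert_of_lt _ (by omega)
  have hf : ∀ W W' : Finset ℕ, W ⊆ Finset.Icc 1 n → (W' = W ∨ W' = insert (n + 1) W) →
      cardLE W' (n + 1) = W'.card := by
    intro W W' hW hW'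
    refine cardLE_eq_card fun x hx => ?_
    have : x = n + 1 ∨ x ∈ W := by
      rcases hW' with rfl | rfl
      · exact Or.inr hx
      · exact Finset.mem_insert.1 hx
    rcases this with rfl | h1
    · exact le_rfl
    · have := Finset.mem_Icc.1 (hW h1); omega
  have f1 := hf U U' hU hU'
  have f2 := hf V V' hV hV'
  constructor
  · rintro ⟨h1, h2⟩
    refine ⟨fun i hi => ?_, by omega⟩
    rw [← (e i hi).1, ← (e i hi).2]
    exact h1 i (by omega)
  · rintro ⟨h1, h2⟩
    refine ⟨fun i hi => ?_, by omega⟩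
    rcases Nat.lt_or_ge n i with hni | hni
    · obtain rfl : i = n + 1 := by omega
      omega
    · rw [(e i hni).1, (e i hni).2]
      exact h1 i hni

theorem ballotCount_succ (n h : ℕ) :
    ballotCount (n + 1) h = ballotCount n (h + 1) + 2 * ballotCount n h +
      if h = 0 then 0 else ballotCount n (h - 1) := by
  classical
  have hn : n + 1 ∉ Finset.Icc 1 n := by simp
  have hIcc : Finset.Icc 1 (n + 1) = insert (n + 1) (Finset.Icc 1 n) := by
    ext x; simp only [Finset.mem_Icc, Finset.mem_insert]; omega
  have hlast : (if h = 0 then 0 else ballotCount n (h - 1)) =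
      ∑ U ∈ (Finset.Icc 1 n).powerset, ∑ V ∈ (Finset.Icc 1 n).powerset,
      if (∀ i ≤ n + 1, i ≤ cardLE (insert (n + 1) U) i + cardLE (insert (n + 1) V) i) ∧
        (insert (n + 1) U).card + (insert (n + 1) V).card = n + 1 + h then 1 else 0 := by
    -- An up step ending at height 0 would start at height -1, which the ballot condition at `n`
    -- forbids.
    split_ifs with h0
    · symm
      refine Finset.sum_eq_zero fun U hU => Finset.sum_eq_zero fun V hV => if_neg ?_
      rw [Finset.mem_powerset] at hU hV
      rintro ⟨h1, h2⟩
      rw [Finset.card_insert_of_notMem fun hm => hn (hU hm),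
        Finset.card_insert_of_notMem fun hm => hn (hV hm)] at h2
      have h3 := h1 n (by omega)
      rw [cardLE_insert_of_lt _ (by omega), cardLE_insert_of_lt _ (by omega)] at h3
      have h4 := cardLE_le_card U n
      have h5 := cardLE_le_card V n
      omega
    · refine Finset.sum_congr rfl fun U hU => Finset.sum_congr rfl fun V hV => ?_
      rw [Finset.mem_powerset] at hU hV
      refine if_congr (ballot_succ_iff hU hV (Or.inr rfl) (Or.inr rfl) ?_).symm rfl rfl
      rw [Finset.card_insert_of_notMem fun hm => hn (hU hm),
        Finset.card_insert_of_notMem fun hm => hn (hV hm)]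
      omega
  rw [hlast, ballotCount, hIcc, Finset.sum_powerset_insert hn]
  simp only [Finset.sum_powerset_insert hn, Finset.sum_add_distrib]
  rw [← add_assoc]
  congr 1
  rw [two_mul, ← add_assoc, ballotCount, ballotCount]
  congr 1
  congr 1
  all_goals
    refine Finset.sum_congr rfl fun U hU => Finset.sum_congr rfl fun V hV => ?_
    rw [Finset.mem_powerset] at hU hV
  · exact if_congr (ballot_succ_iff hU hV (Or.inl rfl) (Or.inl rfl) (by omega)) rfl rfl
  · refine if_congr (ballot_succ_iff hU hV (Or.inl rfl) (Or.inr rfl) ?_) rfl rfl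
    rw [Finset.card_insert_of_notMem fun hm => hn (hV hm)]
    omega
  · refine if_congr (ballot_succ_iff hU hV (Or.inr rfl) (Or.inl rfl) ?_) rfl rfl
    rw [Finset.card_insert_of_notMem fun hm => hn (hU hm)]
    omega

/-- The reflection formula, written without subtraction. Pascal's rule applied twice has the
coefficients 1, 2, 1 of the recurrence for the walks. -/
theorem ballotCount_add_choose (n h : ℕ) :
    ballotCount n h + (2 * n + 1).choose (n + h + 2) = (2 * n + 1).choose (n + h + 1) := by
  induction n generalizing h with
  | zero =>
    rcases h with _ | h
    · simp [ballotCount, cardLE, Finset.filter_singleton]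
    · rw [Nat.choose_eq_zero_of_lt (by omega), Nat.choose_eq_zero_of_lt (by omega)]
      simp [ballotCount]
  | succ n ih =>
    have pascal : ∀ k, (2 * (n + 1) + 1).choose (k + 2) = (2 * n + 1).choose k +
        2 * (2 * n + 1).choose (k + 1) + (2 * n + 1).choose (k + 2) := fun k => by
      rw [show 2 * (n + 1) + 1 = 2 * n + 1 + 1 + 1 by ring, Nat.choose_succ_succ',
        Nat.choose_succ_succ' _ k, Nat.choose_succ_succ' _ (k + 1)]
      ring
    rw [ballotCount_succ, show n + 1 + h + 2 = n + h + 1 + 2 by ring,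
      show n + 1 + h + 1 = n + h + 2 by ring, pascal, pascal]
    have a1 := ih (h + 1)
    have a2 := ih h
    rw [show n + (h + 1) + 2 = n + h + 3 by ring, show n + (h + 1) + 1 = n + h + 2 by ring] at a1
    simp only [show n + h + 1 + 1 = n + h + 2 by ring, show n + h + 1 + 2 = n + h + 3 by ring]
    rcases h with _ | h
    · have a3 : (2 * n + 1).choose n = (2 * n + 1).choose (n + 1) :=
        Nat.choose_symm_of_eq_add (by ring)
      simp only [if_true, Nat.add_zero] at *
      omega
    · have a3 := ih h
      simp only [Nat.add_eq_zero_iff, one_ne_zero, and_false, if_false, Nat.add_sub_cancel]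
      rw [show n + (h + 1) + 3 = n + h + 4 by ring, show n + (h + 1) + 2 = n + h + 3 by ring,
        show n + (h + 1) + 1 = n + h + 2 by ring, show n + (h + 1) = n + h + 1 by ring] at *
      omega

theorem ballotCount_zero_right (n : ℕ) : ballotCount n 0 = catalan (n + 1) := by
  have h1 := ballotCount_add_choose n 0
  have h2 := Nat.choose_succ_right_eq (2 * n + 1) (n + 1)
  have h3 := succ_mul_catalan_eq_centralBinom (n + 1)
  have h4 : (2 * n + 1).choose n = (2 * n + 1).choose (n + 1) :=
    Nat.choose_symm_of_eq_add (by ring)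
  have h5 : (n + 1).centralBinom = 2 * (2 * n + 1).choose (n + 1) := by
    rw [Nat.centralBinom_eq_two_mul_choose, show 2 * (n + 1) = 2 * n + 1 + 1 by ring,
      Nat.choose_succ_succ', h4, ← two_mul]
  rw [h5] at h3
  rw [show 2 * n + 1 - (n + 1) = n by omega] at h2
  simp only [Nat.add_zero] at h1
  refine Nat.eq_of_mul_eq_mul_left (show 0 < n + 1 + 1 by omega) ?_
  rw [h3]
  nlinarith

/-! ### Counting parking biprofiles -/

theorem isParking_append_pos {u v : List ℕ} (h : IsParking (u ++ v)) :
    (∀ x ∈ u, 1 ≤ x) ∧ ∀ x ∈ v, 1 ≤ x :=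
  ⟨fun x hx => h.1 x (List.mem_append_left _ hx), fun x hx => h.1 x (List.mem_append_right _ hx)⟩

theorem mem_parkingBiprofiles {n : ℕ} {b : List (ℕ × ℕ) × List (ℕ × ℕ)} :
    b ∈ parkingBiprofiles n ↔ ∃ u v : List ℕ, u.Pairwise (· ≤ ·) ∧ v.Pairwise (· ≤ ·) ∧
      (IsParking (u ++ v) ∧ (u ++ v).length = n) ∧ b = (profile u, profile v) := by
  simp only [parkingBiprofiles, Finset.mem_image, Set.Finite.mem_toFinset, Prod.exists]
  exact ⟨fun ⟨u, v, ⟨h1, h2, h3, h4⟩, h5⟩ => ⟨u, v, h1, h2, ⟨h3, h4⟩, h5.symm⟩,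
    fun ⟨u, v, h1, h2, ⟨h3, h4⟩, h5⟩ => ⟨u, v, ⟨h1, h2, h3, h4⟩, h5.symm⟩⟩

theorem parkingBiprofiles_spec {n : ℕ} {b : List (ℕ × ℕ) × List (ℕ × ℕ)}
    (hb : b ∈ parkingBiprofiles n) : IsProfileAbove 0 b.1 ∧ IsProfileAbove 0 b.2 ∧
      IsBallot n (cells b.1) (cells b.2) := by
  obtain ⟨u, v, hu, hv, h, rfl⟩ := mem_parkingBiprofiles.1 hb
  obtain ⟨pu, pv⟩ := isParking_append_pos h.1
  obtain ⟨h1, h2⟩ := profile_spec u hu 0 pu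
  obtain ⟨h3, h4⟩ := profile_spec v hv 0 pv
  exact ⟨h1, h3, (isParking_append_iff h2 h4).1 h⟩

theorem card_parkingBiprofiles (n : ℕ) : (parkingBiprofiles n).card = catalan (n + 1) := by
  classical
  rw [← ballotCount_zero_right, ballotCount, ← Finset.sum_product', Finset.sum_boole, Nat.cast_id]
  refine Finset.card_bij (fun b _ => (cells b.1, cells b.2)) ?_ ?_ ?_
  · intro b hb
    obtain ⟨h1, h2, h3⟩ := parkingBiprofiles_spec hb
    obtain ⟨h4, h5⟩ := h3.subset (fun h => lt_irrefl _ (h1.lt_of_mem_cells _ h))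
      (fun h => lt_irrefl _ (h2.lt_of_mem_cells _ h))
    simp only [Finset.mem_filter, Finset.mem_product, Finset.mem_powerset]
    exact ⟨⟨h4, h5⟩, h3⟩
  · intro a ha b hb hab
    obtain ⟨h1, h2, -⟩ := parkingBiprofiles_spec ha
    obtain ⟨h3, h4, -⟩ := parkingBiprofiles_spec hb
    rw [Prod.mk.injEq] at hab
    exact Prod.ext (h1.cells_injective h3 hab.1) (h2.cells_injective h4 hab.2)
  · rintro ⟨U, V⟩ h
    simp only [Finset.mem_filter, Finset.mem_product, Finset.mem_powerset] at h
    obtain ⟨⟨hU, hV⟩, h⟩ := h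
    have oU := occupies_sort (U := U) fun h0 => by have := Finset.mem_Icc.1 (hU h0); omega
    have oV := occupies_sort (U := V) fun h0 => by have := Finset.mem_Icc.1 (hV h0); omega
    have sU : (U.sort (· ≤ ·)).Pairwise (· ≤ ·) := U.pairwise_sort _
    have sV : (V.sort (· ≤ ·)).Pairwise (· ≤ ·) := V.pairwise_sort _
    refine ⟨(profile (U.sort (· ≤ ·)), profile (V.sort (· ≤ ·))), mem_parkingBiprofiles.2
      ⟨_, _, sU, sV, (isParking_append_iff oU oV).2 h, rfl⟩, ?_⟩
    exact Prod.ext ((profile_spec _ sU 0 fun _ => oU.one_le).2.unique oU)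
      ((profile_spec _ sV 0 fun _ => oV.one_le).2.unique oV)

/-! ### Words with a given occupied set. -/

theorem ParkingFunction.isParking (a : ParkingFunction) : IsParking a.word := a.2

theorem IsParking.exists_word_eq {w : List ℕ} (h : IsParking w) :
    ∃ a : ParkingFunction, a.word = w := ⟨⟨w, h⟩, rfl⟩

theorem mem_PF {n : ℕ} {a : ParkingFunction} : a ∈ PF n ↔ a.word.length = n := by
  rw [PF, Set.Finite.mem_toFinset]; rfl

/-- The finite set of words that occupy `U`. -/
noncomputable def wordsOccupying (U : Finset ℕ) : Finset (List ℕ) :=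
  Set.Finite.toFinset (s := {w | Occupies w U}) <|
    (finite_words (U.card + U.sup id)).subset fun w h =>
      ⟨by rw [h.length_eq]; omega, fun _ hx =>
        (Finset.le_sup (f := id) (h.mem hx)).trans (Nat.le_add_left _ _)⟩

theorem mem_wordsOccupying {U : Finset ℕ} {w : List ℕ} : w ∈ wordsOccupying U ↔ Occupies w U := by
  rw [wordsOccupying, Set.Finite.mem_toFinset]; rfl

theorem countLE_map_cardLE {w : List ℕ} {U : Finset ℕ} (h : ∀ x ∈ w, x ∈ U) (j : ℕ) :
    countLE (w.map (cardLE U)) (cardLE U j) = countLE w j := by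
  rw [countLE, List.countP_map]
  refine List.countP_congr fun x hx => ?_
  simp only [Function.comp, decide_eq_true_eq]
  exact cardLE_le_iff (h x hx)

/-- Relabelling the spots of `U` by their ranks. -/
theorem occupies_iff_map {w : List ℕ} {U : Finset ℕ} (hU : 0 ∉ U) (hw : ∀ x ∈ w, x ∈ U) :
    Occupies w U ↔ IsParking (w.map (cardLE U)) ∧ w.length = U.card ∧
      ∀ j ∉ U, countLE (w.map (cardLE U)) (cardLE U j) = cardLE U j := by
  constructor
  · intro h
    refine ⟨isParking_iff.2 ⟨fun y hy => ?_, fun i hi => ?_⟩, h.length_eq, fun j hj => ?_⟩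
    · obtain ⟨x, hx, rfl⟩ := List.mem_map.1 hy
      have := cardLE_lt (hw x hx) (h.one_le hx)
      omega
    · rw [List.length_map, h.length_eq] at hi
      obtain ⟨j, rfl, -⟩ := cardLE_surj hU hi
      rw [countLE_map_cardLE hw]
      exact h.le j
    · rw [countLE_map_cardLE hw]
      exact h.eq hj
  · rintro ⟨h1, h2, h3⟩
    refine ⟨hU, fun j => ?_⟩
    rw [← countLE_map_cardLE hw]
    refine ⟨(isParking_iff.1 h1).2 _ ?_, h3 j⟩
    rw [List.length_map, h2]
    exact cardLE_le_card U j

/-! ### Balanced words. -/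

/-- The condition that exactly `t` letters of the word are at most `t`, for the partial sums `t`
of `I`. -/
def IsBalanced (I w : List ℕ) : Prop := ∀ J, J <+: I → countLE w J.sum = J.sum

theorem List.Perm.isBalanced {I u v : List ℕ} (h : u.Perm v) (hu : IsBalanced I u) :
    IsBalanced I v := fun J hJ => by rw [← h.countLE_eq]; exact hu J hJ

/-- The partial sums of the bottom row are exactly the ranks at free spots. -/
theorem isBalanced_bottomRow_iff {p : List (ℕ × ℕ)} (hp : IsProfileAbove 0 p) {w : List ℕ} :
    IsBalanced (bottomRow p) w ↔
      ∀ j ∉ cells p, countLE w (cardLE (cells p) j) = cardLE (cells p) j := by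
  constructor
  · intro h j hj
    obtain ⟨J, hJ, e⟩ := exists_prefix_of_notMem hp hj
    rw [e, h J hJ]
  · intro h J hJ
    obtain ⟨j, -, hj, e⟩ := exists_notMem_of_prefix hp hJ
    rw [← e, h j hj]

theorem countLE_add_of_filter {i : ℕ} {w v : List ℕ}
    (hv : w.filter (fun x => decide (i < x)) = v.map (fun x => x + i)) (t : ℕ) :
    countLE w (i + t) = countLE w i + countLE v t := by
  have h1 : countLE (w.filter (fun x => decide (i < x))) (i + t) = countLE v t := by
    rw [hv, countLE, List.countP_map]
    refine List.countP_congr fun x _ => ?_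
    simp only [Function.comp, decide_eq_true_eq]; omega
  rw [← h1]
  clear h1 hv
  simp only [countLE, List.countP_filter]
  induction w with
  | nil => rfl
  | cons x w ih =>
    simp only [List.countP_cons, Bool.and_eq_true, decide_eq_true_eq] at ih ⊢
    rw [ih]
    split_ifs <;> omega

/-- The partial sums of `i :: I` are 0 and `i + t`, for `t` a partial sum of `I`; beyond `i` only
the large letters matter. -/
theorem isBalanced_cons_iff {i : ℕ} {I w v : List ℕ} (hw : ∀ x ∈ w, 1 ≤ x)
    (hv : w.filter (fun x => decide (i < x)) = v.map (fun x => x + i)) :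
    IsBalanced (i :: I) w ↔ countLE w i = i ∧ IsBalanced I v := by
  have key := countLE_add_of_filter hv
  constructor
  · intro h
    have h1 : countLE w i = i := by
      simpa using h [i] (List.prefix_cons_iff.2 (Or.inr ⟨[], rfl, List.nil_prefix⟩))
    refine ⟨h1, fun J hJ => ?_⟩
    have h2 := h (i :: J) (List.prefix_cons_iff.2 (Or.inr ⟨J, rfl, hJ⟩))
    rw [List.sum_cons, key, h1] at h2
    omega
  · rintro ⟨h1, h2⟩ J hJ
    rcases List.prefix_cons_iff.1 hJ with rfl | ⟨J, rfl, hJ'⟩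
    · exact countLE_zero hw
    · rw [List.sum_cons, key, h1, h2 J hJ']

/-! ### Products of the `G` and the coproduct. -/

namespace PQSym

variable (R : Type*) [CommRing R]

open Classical in
/-- `F_{Park(w)}`, for words `w` on the positive integers. -/
noncomputable def parkF (w : List ℕ) : PQSym R :=
  -- The default 0 plays no role: only words of positive letters enter the sums below.
  if h : ∀ x ∈ w, 1 ≤ x then F R (Park w h) else 0

open Classical in
/-- The finite set of parking functions of length `I.sum` that are balanced for `I`. -/
noncomputable def balancedPF (I : List ℕ) : Finset ParkingFunction :=
  (PF I.sum).filter fun c => IsBalanced I c.word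

theorem mem_balancedPF {I : List ℕ} {c : ParkingFunction} :
    c ∈ balancedPF I ↔ c.word.length = I.sum ∧ IsBalanced I c.word := by
  classical
  rw [balancedPF, Finset.mem_filter, mem_PF]

theorem mulMap_F (a b : ParkingFunction) :
    mulMap R (F R a) (F R b) = ∑ c ∈ shiftedShuffle a b, F R c := by
  simp only [mulMap, F, Module.Basis.constr_basis]

/-- A parking function balanced for `i :: I` is, in exactly one way, a shifted shuffle: its letters
at most `i` form a parking function of length `i`, and the others, lowered by `i`, one that is
balanced for `I`. -/
theorem G_mul_sum_balancedPF (i : ℕ) (I : List ℕ) :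
    G R i * ∑ b ∈ balancedPF I, F R b = ∑ c ∈ balancedPF (i :: I), F R c := by
  have hmul : G R i * ∑ b ∈ balancedPF I, F R b =
      ∑ a ∈ PF i, ∑ b ∈ balancedPF I, ∑ c ∈ shiftedShuffle a b, F R c := by
    change mulMap R _ _ = _
    rw [G, map_sum (mulMap R), LinearMap.sum_apply]
    refine Finset.sum_congr rfl fun a _ => ?_
    rw [map_sum]
    exact Finset.sum_congr rfl fun b _ => mulMap_F R a b
  rw [hmul, ← Finset.sum_product', Finset.sum_sigma']
  refine Finset.sum_bij (fun x _ => x.2) ?_ ?_ ?_ (fun _ _ => rfl)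
  · rintro ⟨⟨a, b⟩, c⟩ h
    simp only [Finset.mem_sigma, Finset.mem_product, shiftedShuffle, Finset.mem_filter, mem_PF,
      mem_balancedPF] at h ⊢
    obtain ⟨⟨ha, hb, hbal⟩, hc, h1, h2⟩ := h
    have ha' : a.length = i := ha
    have hb' : b.length = I.sum := hb
    rw [ha'] at h1 h2
    refine ⟨by rw [hc, ha', hb', List.sum_cons], (isBalanced_cons_iff c.isParking.1 h2).2 ⟨?_, hbal⟩⟩
    rw [countLE, List.countP_eq_length_filter, h1, ha]
  · rintro ⟨⟨a, b⟩, c⟩ h ⟨⟨a', b'⟩, c'⟩ h' (rfl : c = c')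
    simp only [Finset.mem_sigma, Finset.mem_product, shiftedShuffle, Finset.mem_filter, mem_PF,
      mem_balancedPF] at h h'
    obtain ⟨⟨ha, -⟩, -, h1, h2⟩ := h
    obtain ⟨⟨ha', -⟩, -, h1', h2'⟩ := h'
    have e : a.length = i := ha
    have e' : a'.length = i := ha'
    rw [e] at h1 h2
    rw [e'] at h1' h2'
    obtain rfl : a = a' := Subtype.ext (h1.symm.trans h1')
    obtain rfl : b = b' := Subtype.ext
      (List.map_injective_iff.2 (fun x y hxy => by simpa using hxy) (h2.symm.trans h2'))
    rfl
  · intro c hc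
    obtain ⟨hlen, hbal⟩ := mem_balancedPF.1 hc
    have hv : c.word.filter (fun x => decide (i < x)) =
        ((c.word.filter (fun x => decide (i < x))).map (fun x => x - i)).map (fun x => x + i) := by
      rw [List.map_map]
      conv_lhs => rw [← List.map_id (List.filter _ _)]
      refine List.map_congr_left fun x hx => ?_
      have := (List.mem_filter.1 hx).2
      simp only [decide_eq_true_eq] at this
      simp only [Function.comp, id]
      omega
    obtain ⟨hi, hbal'⟩ := (isBalanced_cons_iff c.isParking.1 hv).1 hbal
    have hlen1 : (c.word.filter (fun x => decide (x ≤ i))).length = i := by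
      rw [← List.countP_eq_length_filter]; exact hi
    have hlen2 : (c.word.filter (fun x => decide (i < x))).length = I.sum := by
      have h1 : c.word.length = c.word.countP (fun x => decide (x ≤ i)) +
          c.word.countP (fun x => decide (i < x)) :=
        (List.length_eq_countP_add_countP _).trans
          (congrArg _ (List.countP_congr fun x _ => by simp))
      rw [← List.countP_eq_length_filter]
      rw [hlen, List.sum_cons] at h1
      unfold countLE at hi
      omega
    have ha : IsParking (c.word.filter (fun x => decide (x ≤ i))) := by
      refine ⟨fun x hx => c.isParking.1 x (List.mem_of_mem_filter hx), fun k hk => ?_⟩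
      rw [hlen1] at hk
      refine (c.isParking.2 k ?_).trans (le_of_eq ?_)
      · rw [hlen, List.sum_cons]; omega
      · rw [List.countP_filter]
        refine List.countP_congr fun x _ => ?_
        simp only [decide_eq_true_eq, Bool.and_eq_true]
        omega
    have hb : IsParking ((c.word.filter (fun x => decide (i < x))).map (fun x => x - i)) := by
      refine ⟨fun x hx => ?_, fun k hk => ?_⟩
      · obtain ⟨y, hy, rfl⟩ := List.mem_map.1 hx
        have := (List.mem_filter.1 hy).2
        simp only [decide_eq_true_eq] at this
        omega
      · rw [List.length_map, hlen2] at hk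
        have h1 : i + k ≤ countLE c.word (i + k) := c.isParking.2 (i + k) (by
          rw [hlen, List.sum_cons]; omega)
        have h2 : countLE c.word (i + k) = countLE c.word i +
            countLE ((c.word.filter (fun x => decide (i < x))).map (fun x => x - i)) k :=
          countLE_add_of_filter hv k
        rw [h2, hi] at h1
        exact Nat.le_of_add_le_add_left h1
    obtain ⟨a, hA⟩ := ha.exists_word_eq
    obtain ⟨b, hB⟩ := hb.exists_word_eq
    have e1 : a.length = i := by rw [ParkingFunction.length, hA, hlen1]
    have e2 : b.length = I.sum := by rw [ParkingFunction.length, hB, List.length_map, hlen2]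
    refine ⟨⟨(a, b), c⟩, ?_, rfl⟩
    simp only [Finset.mem_sigma, Finset.mem_product, shiftedShuffle, Finset.mem_filter, mem_PF,
      mem_balancedPF]
    rw [e1, e2, hA, hB]
    exact ⟨⟨hlen1, by rw [List.length_map, hlen2], hbal'⟩, by rw [hlen, List.sum_cons], rfl, hv⟩

theorem Gpow_eq_sum (I : List ℕ) : Gpow R I = ∑ c ∈ balancedPF I, F R c := by
  induction I with
  | nil =>
    have hone : (1 : PQSym R) = ∑ c ∈ balancedPF [], F R c := by
      obtain ⟨e, he⟩ : ∃ e : ParkingFunction, e.word = [] ∧ (1 : PQSym R) = F R e :=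
        ⟨_, rfl, rfl⟩
      rw [he.2, ← Finset.sum_singleton (F R) e]
      refine Finset.sum_congr ?_ fun _ _ => rfl
      ext c
      rw [mem_balancedPF, Finset.mem_singleton, List.sum_nil, List.length_eq_zero_iff]
      constructor
      · rintro rfl
        refine ⟨he.1, fun J hJ => ?_⟩
        rw [List.prefix_nil.1 hJ, he.1]
        rfl
      · exact fun h => Subtype.ext (h.1.trans he.1.symm)
    exact hone
  | cons i I ih =>
    change G R i * Gpow R I = _
    rw [ih, G_mul_sum_balancedPF]

/-- Ranking is injective on `cells p`, and its image of the occupying words is cut out by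
`occupies_iff_map`: the equality at free spots becomes balance. -/
theorem sum_parkF (p : List (ℕ × ℕ)) (hp : IsProfileAbove 0 p) :
    ∑ w ∈ wordsOccupying (cells p), parkF R w = Gpow R (bottomRow p) := by
  rw [Gpow_eq_sum]
  have hU : 0 ∉ cells p := fun h => lt_irrefl _ (hp.lt_of_mem_cells _ h)
  have hleft := (cardLE_injOn (cells p)).leftInvOn_invFunOn
  refine Finset.sum_bij
    (fun w hw => Park w fun x hx => (mem_wordsOccupying.1 hw).one_le hx) ?_ ?_ ?_ ?_
  · intro w hw
    have h := mem_wordsOccupying.1 hw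
    have e : (Park w fun x hx => h.one_le hx).word = w.map (cardLE (cells p)) := h.park_eq
    rw [mem_balancedPF, e, isBalanced_bottomRow_iff hp, List.length_map, ← card_cells hp]
    exact ((occupies_iff_map hU fun _ => h.mem).1 h).2
  · intro u hu v hv huv
    have h := mem_wordsOccupying.1 hu
    have h' := mem_wordsOccupying.1 hv
    have e : u.map (cardLE (cells p)) = v.map (cardLE (cells p)) := by
      rw [← h.park_eq, ← h'.park_eq]
      exact congrArg Subtype.val huv
    have hinv : ∀ {w : List ℕ}, Occupies w (cells p) →
        (w.map (cardLE (cells p))).map (Function.invFunOn (cardLE (cells p)) (cells p)) = w := by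
      intro w hw
      rw [List.map_map]
      conv_rhs => rw [← List.map_id w]
      exact List.map_congr_left fun x hx => hleft (hw.mem hx)
    rw [← hinv h, e, hinv h']
  · intro c hc
    obtain ⟨h1, h2⟩ := mem_balancedPF.1 hc
    rw [← card_cells hp] at h1
    -- The letters of `c` lie between 1 and the size of `cells p`, so each is the rank of an
    -- occupied spot.
    have hex : ∀ y ∈ c.word, ∃ x ∈ (cells p : Set ℕ), cardLE (cells p) x = y := by
      intro y hy
      have hle : y ≤ (cells p).card := h1 ▸ c.isParking.le_length y hy
      obtain ⟨x, hx, hx'⟩ := cardLE_surj hU hle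
      exact ⟨x, hx' (c.isParking.1 y hy), hx⟩
    have e : (c.word.map (Function.invFunOn (cardLE (cells p)) (cells p))).map
        (cardLE (cells p)) = c.word := by
      rw [List.map_map]
      conv_rhs => rw [← List.map_id c.word]
      exact List.map_congr_left fun y hy => Function.invFunOn_eq (hex y hy)
    have hm : ∀ x ∈ c.word.map (Function.invFunOn (cardLE (cells p)) (cells p)),
        x ∈ cells p := by
      intro x hx
      obtain ⟨y, hy, rfl⟩ := List.mem_map.1 hx
      exact Function.invFunOn_mem (hex y hy)
    have ho : Occupies (c.word.map (Function.invFunOn (cardLE (cells p)) (cells p)))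
        (cells p) := by
      rw [occupies_iff_map hU hm, e, List.length_map]
      exact ⟨c.isParking, h1, (isBalanced_bottomRow_iff hp).1 h2⟩
    exact ⟨_, mem_wordsOccupying.2 ho, Subtype.ext (ho.park_eq.trans e)⟩
  · intro w hw
    rw [parkF, dif_pos fun x hx => (mem_wordsOccupying.1 hw).one_le hx]

/-! ### Membership in `CQSym` -/

-- Grouped by nondecreasing rearrangement, a permutation-invariant condition selects whole
-- rearrangement classes, each of which sums to some `P R π`.
open Classical in
theorem sum_mem_CQSym (n : ℕ) (Q : List ℕ → Prop) (hQ : ∀ u v : List ℕ, u.Perm v → Q u → Q v) :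
    ∑ a ∈ (PF n).filter (fun a => Q a.word), F R a ∈ CQSym R := by
  let srt : ParkingFunction → ParkingFunction := fun a =>
    ⟨a.word.insertionSort (· ≤ ·), (List.perm_insertionSort (· ≤ ·) a.word).symm.isParking a.2⟩
  have hsrt : ∀ a, (srt a).word.Perm a.word := fun a => List.perm_insertionSort (· ≤ ·) a.word
  have hsorted : ∀ a, (srt a).word.Pairwise (· ≤ ·) := fun a =>
    List.pairwise_insertionSort (· ≤ ·) a.word
  rw [← Finset.sum_fiberwise_of_maps_to (g := srt)
    (t := ((PF n).filter (fun a => Q a.word)).image srt)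
    fun a ha => Finset.mem_image_of_mem _ ha]
  refine Submodule.sum_mem _ fun π hπ => Submodule.subset_span ⟨π, ?_, ?_⟩
  · obtain ⟨b, -, rfl⟩ := Finset.mem_image.1 hπ
    exact hsorted b
  · obtain ⟨b, hb, rfl⟩ := Finset.mem_image.1 hπ
    rw [Finset.mem_filter, mem_PF] at hb
    rw [P]
    refine Finset.sum_congr ?_ fun _ _ => rfl
    ext a
    simp only [Finset.mem_filter, mem_PF]
    have hl : (srt b).length = n := (hsrt b).length_eq.trans hb.1
    rw [hl]
    constructor
    · rintro ⟨⟨h1, -⟩, h2⟩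
      exact ⟨h1, h2 ▸ (hsrt a).symm⟩
    · rintro ⟨h1, h2⟩
      refine ⟨⟨h1, hQ _ _ ((hsrt b).symm.trans h2.symm) hb.2⟩, Subtype.ext ?_⟩
      exact ((hsrt a).trans h2).eq_of_pairwise (fun _ _ _ _ => le_antisymm) (hsorted a) (hsorted b)

theorem Gpow_mem_CQSym (I : List ℕ) : Gpow R I ∈ CQSym R := by
  rw [Gpow_eq_sum, balancedPF]
  exact sum_mem_CQSym R _ _ fun _ _ h hu => h.isBalanced hu

theorem G_mem_CQSym (n : ℕ) : G R n ∈ CQSym R := by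
  have := sum_mem_CQSym R n (fun _ => True) fun _ _ _ _ => trivial
  rwa [Finset.filter_true] at this

/-! ### The coproduct of `G n` -/

theorem parkF_of_pos {w : List ℕ} (h : ∀ x ∈ w, 1 ≤ x) : parkF R w = F R (Park w h) := dif_pos h

theorem comul_F (a : ParkingFunction) : comul R (F R a) =
    ∑ i ∈ Finset.range (a.length + 1), parkF R (a.word.take i) ⊗ₜ[R] parkF R (a.word.drop i) := by
  rw [comul, F, Module.Basis.constr_basis]
  refine Finset.sum_congr rfl fun i _ => ?_
  rw [parkF_of_pos R fun x hx => a.isParking.1 x (List.mem_of_mem_take hx),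
    parkF_of_pos R fun x hx => a.isParking.1 x (List.mem_of_mem_drop hx)]

theorem finite_parkingFactorizations (n : ℕ) :
    {p : List ℕ × List ℕ | IsParking (p.1 ++ p.2) ∧ (p.1 ++ p.2).length = n}.Finite := by
  refine ((finite_words n).prod (finite_words n)).subset ?_
  rintro ⟨u, v⟩ ⟨h, hn⟩
  have h' := h.le_length
  dsimp only at h h' hn
  rw [hn] at h'
  rw [List.length_append] at hn
  exact ⟨⟨by dsimp; omega, fun x hx => h' x (List.mem_append_left _ hx)⟩,
    ⟨by dsimp; omega, fun x hx => h' x (List.mem_append_right _ hx)⟩⟩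

theorem comul_G_eq_sum (n : ℕ) : comul R (G R n) =
    ∑ p ∈ (finite_parkingFactorizations n).toFinset, parkF R p.1 ⊗ₜ[R] parkF R p.2 := by
  rw [G, map_sum]
  simp only [comul_F]
  rw [Finset.sum_sigma']
  refine Finset.sum_bij (fun x _ => (x.1.word.take x.2, x.1.word.drop x.2)) ?_ ?_ ?_
    (fun _ _ => rfl)
  · rintro ⟨a, i⟩ h
    rw [Finset.mem_sigma, mem_PF] at h
    simp only [Set.Finite.mem_toFinset, Set.mem_ofPred_eq, List.take_append_drop]
    exact ⟨a.2, h.1⟩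
  · rintro ⟨a, i⟩ h ⟨b, j⟩ h' hab
    simp only [Finset.mem_sigma, Finset.mem_range, Prod.mk.injEq] at h h' hab
    have e : a = b := Subtype.ext (by
      change a.word = b.word
      rw [← List.take_append_drop i a.word, hab.1, hab.2, List.take_append_drop])
    subst e
    have e1 := congrArg List.length hab.1
    rw [List.length_take, List.length_take] at e1
    have h1 : i < a.word.length + 1 := h.2
    have h2 : j < a.word.length + 1 := h'.2
    -- Both cuts are at most the length of the word, so the minima in `e1` are `i` and `j`.
    obtain rfl : i = j := by omega
    rfl
  · rintro ⟨u, v⟩ h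
    simp only [Set.Finite.mem_toFinset, Set.mem_ofPred_eq] at h
    refine ⟨⟨⟨u ++ v, h.1⟩, u.length⟩, ?_, ?_⟩
    · rw [Finset.mem_sigma, mem_PF, Finset.mem_range]
      refine ⟨h.2, ?_⟩
      change u.length < (u ++ v).length + 1
      rw [List.length_append]; omega
    · simp [ParkingFunction.word]

/-- Since the parking condition sees only the occupied sets, the fibre over a biprofile is a full
product of two sets of words, and its sum factors as a tensor. -/
theorem comul_G (n : ℕ) : comul R (G R n) = ∑ b ∈ parkingBiprofiles n,
    Gpow R (bottomRow b.1) ⊗ₜ[R] Gpow R (bottomRow b.2) := by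
  classical
  rw [comul_G_eq_sum, ← Finset.sum_fiberwise_of_maps_to
    (g := fun p => (sortedProfile p.1, sortedProfile p.2)) (t := parkingBiprofiles n)]
  · refine Finset.sum_congr rfl fun b hb => ?_
    obtain ⟨h1, h2, h3⟩ := parkingBiprofiles_spec hb
    rw [← sum_parkF R _ h1, ← sum_parkF R _ h2, TensorProduct.sum_tmul]
    simp only [TensorProduct.tmul_sum]
    rw [← Finset.sum_product']
    refine Finset.sum_congr ?_ fun _ _ => rfl
    ext ⟨u, v⟩
    simp only [Finset.mem_filter, Set.Finite.mem_toFinset, Set.mem_ofPred_eq, Finset.mem_product,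
      mem_wordsOccupying, Prod.ext_iff]
    constructor
    · rintro ⟨h, h4, h5⟩
      obtain ⟨pu, pv⟩ := isParking_append_pos h.1
      exact ⟨(sortedProfile_eq_iff pu h1).1 h4, (sortedProfile_eq_iff pv h2).1 h5⟩
    · rintro ⟨h4, h5⟩
      exact ⟨(isParking_append_iff h4 h5).2 h3,
        (sortedProfile_eq_iff (fun _ => h4.one_le) h1).2 h4,
        (sortedProfile_eq_iff (fun _ => h5.one_le) h2).2 h5⟩
  · rintro ⟨u, v⟩ h
    simp only [Set.Finite.mem_toFinset, Set.mem_ofPred_eq] at h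
    have pu := List.perm_insertionSort (· ≤ ·) u
    have pv := List.perm_insertionSort (· ≤ ·) v
    have hp := pu.append pv
    exact mem_parkingBiprofiles.2 ⟨_, _, List.pairwise_insertionSort (· ≤ ·) u,
      List.pairwise_insertionSort (· ≤ ·) v,
      ⟨hp.symm.isParking h.1, hp.length_eq.trans h.2⟩, rfl⟩

end PQSym

theorem mainTheorem7 (R : Type*) [CommRing R] (n : ℕ) :
    PQSym.G R n ∈ PQSym.CQSym R ∧
    (∀ I : List ℕ, PQSym.Gpow R I ∈ PQSym.CQSym R) ∧
    PQSym.comul R (PQSym.G R n) =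
      ∑ b ∈ parkingBiprofiles n,
        PQSym.Gpow R (bottomRow b.1) ⊗ₜ[R] PQSym.Gpow R (bottomRow b.2) ∧
    (parkingBiprofiles n).card = catalan (n + 1) :=
  ⟨PQSym.G_mem_CQSym R n, PQSym.Gpow_mem_CQSym R, PQSym.comul_G R n, card_parkingBiprofiles n⟩
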